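/- Let $K$ be a field and let $A$ be an $m\times n$ integer matrix such that the lattice $\mathcal L=\ker_{\mathbb Z}(A)\subseteq\mathbb Z^n$ is positive, i.e. $\mathcal L\cap\mathbb N^n=\{\mathbf 0\}$ (here $0\in\mathbb N$). Write each $\mathbf u\in\mathbb Z^n$ as $\mathbf u=\mathbf u^+-\mathbf u^-$ with $\mathbf u^+,\mathbf u^-\in\mathbb N^n$ of disjoint support. A Markov basis of $A$ is a finite set $M\subseteq\mathcal L$ such that whenever $\mathbf w,\mathbf t\in\mathbb N^n$ and $\mathbf w-\mathbf t\in\mathcal L$, there are $s\ge 0$ and $\mathbf v_1,\dots,\mathbf v_s$ with $\mathbf v_i\in M$ or $-\mathbf v_i\in M$, such that $\mathbf w+\sum_{i=1}^p\mathbf v_i\in\mathbb N^n$ for all $0\le p\le s$ and $\mathbf w+\sum_{i=1}^s\mathbf v_i=\mathbf t$. It is minimal if no proper subset of it is a Markov basis of $A$. The universal Markov basis $\mathcal M$ of $A$ is the set of all $\mathbf u$ such that $\mathbf u$ or $-\mathbf u$ belongs to a minimal Markov basis of $A$ of minimal cardinality (among the minimal Markov bases of $A$). The universal Gröbner basis $\mathcal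 U$ of $A$ is the set of all $\mathbf u\in\mathcal L$ such that $x^{\mathbf u^+}-x^{\mathbf u^-}$ belongs to the reduced Gröbner basis, for some term order, of the lattice ideal $\langle x^{\mathbf v}-x^{\mathbf w} : \mathbf v,\mathbf w\in\mathbb N^n,\ A\mathbf v=A\mathbf w\rangle\subseteq K[x_1,\dots,x_n]$. For $\mathbf u\in\mathcal L$ let $\mathcal F_{\mathbf u}=\{\mathbf t\in\mathbb N^n:\mathbf u^+-\mathbf t\in\mathcal L\}$, and let $G_{\mathbf u}$ be the graph with vertex set $\mathcal F_{\mathbf u}$ in which two distinct vertices are adjacent if and only if they have a common nonzero coordinate (that is, for some $i$ the $i$-th coordinates of both are nonzero). The Markov polytopes of $\mathcal F_{\mathbf u}$ are the convex hulls in $\mathbb R^n$ of the connected components of $G_{\mathbf u}$. Then, for every $\mathbf u\in\mathcal M$: $\mathbf u\in\mathcal U$ if and only if $\mathbf u^+$ and $\mathbf u^-$ are vertices of two different Markov polytopes of $\mathcal F_{\mathbf u}$, that is, there are Markov polytopes $P\ne Q$ of $\mathcal F_{\mathbf u}$ such that $\mathbf u^+$ is a vertex of $P$ and $\mathbf u^-$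 is a vertex of $Q$. -/

import Mathlib

namespace MarkovBases

/-- A vector of `ℕⁿ` seen in `ℤⁿ`. -/
def toInt {n : ℕ} (w : Fin n → ℕ) : Fin n → ℤ := fun i => (w i : ℤ)

/-- A vector of `ℕⁿ` seen in `ℝⁿ`. -/
def toReal {n : ℕ} (w : Fin n → ℕ) : Fin n → ℝ := fun i => (w i : ℝ)

/-- The positive part `u⁺ ∈ ℕⁿ` of `u ∈ ℤⁿ`, so that `u = u⁺ - u⁻`. -/
def posVec {n : ℕ} (u : Fin n → ℤ) : Fin n → ℕ := fun i => (u i).toNat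

/-- The negative part `u⁻ ∈ ℕⁿ` of `u ∈ ℤⁿ`, so that `u = u⁺ - u⁻`. -/
def negVec {n : ℕ} (u : Fin n → ℤ) : Fin n → ℕ := fun i => (-u i).toNat

theorem toInt_posVec_sub_toInt_negVec {n : ℕ} (u : Fin n → ℤ) :
    toInt (posVec u) - toInt (negVec u) = u := by
  funext i
  simp only [toInt, posVec, negVec, Pi.sub_apply]
  omega

/-- The lattice `L(A) = ker_ℤ(A) ⊆ ℤⁿ`. -/
def kerLattice {m n : ℕ} (A : Matrix (Fin m) (Fin n) ℤ) : Submodule ℤ (Fin n → ℤ) :=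
  LinearMap.ker A.mulVecLin

/-- A lattice `L ⊆ ℤⁿ` is positive if `L ∩ ℕⁿ = {0}`. -/
def IsPositiveLattice {n : ℕ} (L : Submodule ℤ (Fin n → ℤ)) : Prop :=
  {v : Fin n → ℤ | v ∈ L ∧ 0 ≤ v} = {0}

/-- `M` connects `w` to `u`: one can walk from `w` to `u` inside `ℕⁿ` by finitely many steps,
each of which is an element of `M` or the negative of one. -/
def Connects {n : ℕ} (M : Set (Fin n → ℤ)) (w u : Fin n → ℕ) : Prop :=
  ∃ (s : ℕ) (v : ℕ → Fin n → ℤ),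
    (∀ i < s, v i ∈ M ∨ -v i ∈ M) ∧
    (∀ p ≤ s, 0 ≤ toInt w + ∑ i ∈ Finset.range p, v i) ∧
    toInt w + ∑ i ∈ Finset.range s, v i = toInt u

/-- A Markov basis of `A`: a finite subset of `L(A)` that connects any two vectors of `ℕⁿ`
whose difference lies in `L(A)`. -/
def IsMarkovBasis {m n : ℕ} (A : Matrix (Fin m) (Fin n) ℤ) (M : Finset (Fin n → ℤ)) : Prop :=
  (∀ v ∈ M, v ∈ kerLattice A) ∧
  ∀ w u : Fin n → ℕ, toInt w - toInt u ∈ kerLattice A → Connects (M : Set (Fin n → ℤ)) w u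

/-- A Markov basis is minimal if no proper subset of it is a Markov basis. -/
def IsMinimalMarkovBasis {m n : ℕ} (A : Matrix (Fin m) (Fin n) ℤ)
    (M : Finset (Fin n → ℤ)) : Prop :=
  IsMarkovBasis A M ∧ ∀ N : Finset (Fin n → ℤ), N ⊂ M → ¬ IsMarkovBasis A N

/-- The universal Markov basis of `A`: the union of all minimal Markov bases of minimal
cardinality, where `u` and `-u` are identified. -/
def universalMarkovBasis {m n : ℕ} (A : Matrix (Fin m) (Fin n) ℤ) : Set (Fin n → ℤ) :=
  {u | ∃ M : Finset (Fin n → ℤ), IsMinimalMarkovBasis A M ∧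
    (∀ N : Finset (Fin n → ℤ), IsMinimalMarkovBasis A N → M.card ≤ N.card) ∧
    (u ∈ M ∨ -u ∈ M)}

/-- The monomial `x^w`. -/
noncomputable def xpow (K : Type*) [Field K] {n : ℕ} (w : Fin n → ℕ) : MvPolynomial (Fin n) K :=
  MvPolynomial.monomial (Finsupp.equivFunOnFinite.symm w) 1

/-- The lattice ideal `⟨x^u - x^v : A u = A v⟩` of `K[x₁, …, xₙ]`. -/
noncomputable def latticeIdeal (K : Type*) [Field K] {m n : ℕ} (A : Matrix (Fin m) (Fin n) ℤ) :
    Ideal (MvPolynomial (Fin n) K) :=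
  Ideal.span {f | ∃ u v : Fin n → ℕ,
    A.mulVec (toInt u) = A.mulVec (toInt v) ∧ f = xpow K u - xpow K v}

/-- `G` is the reduced Gröbner basis of `I` for the term order `ord`: a finite subset of `I` of
monic polynomials whose leading terms generate the initial ideal of `I`, such that no monomial of
an element of `G` is divisible by the leading monomial of another element of `G`. -/
def IsReducedGroebnerBasis {K : Type*} [Field K] {n : ℕ} (ord : MonomialOrder (Fin n))
    (I : Ideal (MvPolynomial (Fin n) K)) (G : Set (MvPolynomial (Fin n) K)) : Prop :=
  G.Finite ∧ G ⊆ I ∧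
  Ideal.span (ord.leadingTerm '' G) =
    Ideal.span (ord.leadingTerm '' (I : Set (MvPolynomial (Fin n) K))) ∧
  (∀ g ∈ G, ord.Monic g) ∧
  ∀ g ∈ G, ∀ h ∈ G, h ≠ g → ∀ d ∈ g.support, ¬ ord.degree h ≤ d

/-- The universal Gröbner basis of `A`: all `u ∈ L(A)` such that `x^{u⁺} - x^{u⁻}` belongs to the
reduced Gröbner basis of the lattice ideal for some term order. -/
def universalGroebnerBasis (K : Type*) [Field K] {m n : ℕ} (A : Matrix (Fin m) (Fin n) ℤ) :
    Set (Fin n → ℤ) :=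
  {u | u ∈ kerLattice A ∧ ∃ (ord : MonomialOrder.{0, 0} (Fin n))
    (G : Set (MvPolynomial (Fin n) K)),
    IsReducedGroebnerBasis ord (latticeIdeal K A) G ∧ xpow K (posVec u) - xpow K (negVec u) ∈ G}

/-- The fiber `F_u = {t ∈ ℕⁿ : u⁺ - t ∈ L(A)}`. -/
def fiber {m n : ℕ} (A : Matrix (Fin m) (Fin n) ℤ) (u : Fin n → ℤ) : Set (Fin n → ℕ) :=
  {t | toInt (posVec u) - toInt t ∈ kerLattice A}

/-- The graph `G_u` on the fiber `F_u`: two vertices are joined when they have a common nonzero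
coordinate. -/
def fiberGraph {m n : ℕ} (A : Matrix (Fin m) (Fin n) ℤ) (u : Fin n → ℤ) :
    SimpleGraph (fiber A u) where
  Adj w₁ w₂ := w₁ ≠ w₂ ∧ ∃ i, w₁.1 i ≠ 0 ∧ w₂.1 i ≠ 0
  symm := ⟨fun _ _ h => ⟨h.1.symm, h.2.imp fun _ hi => ⟨hi.2, hi.1⟩⟩⟩
  loopless := ⟨fun _ h => h.1 rfl⟩

/-- The Markov polytopes of `F_u`: the convex hulls in `ℝⁿ` of the connected components
of `G_u`. -/
def markovPolytopes {m n : ℕ} (A : Matrix (Fin m) (Fin n) ℤ) (u : Fin n → ℤ) :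
    Set (Set (Fin n → ℝ)) :=
  {P | ∃ C : (fiberGraph A u).ConnectedComponent,
    P = convexHull ℝ ((fun w : fiber A u => toReal w.1) '' C.supp)}

end MarkovBases

open MarkovBases

namespace MarkovBases

/-! ### Fibers of a positive lattice -/

section Basic

variable {m n : ℕ}

/-! Positivity makes every fiber an antichain (`eq_of_le_of_mulVec_eq`) and gives a strictly
positive weight that is constant on fibers (`exists_pos_grading`). Vectors in different components
of `G_u` have disjoint supports.

If `u` or `-u` lies in a minimal Markov basis, then `u⁺` and `u⁻` lie in different components
(`not_reachable_of_minimal`). Indeed, two fiber vectors sharing a coordinate are joined by a walk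
avoiding `±u`, so a path in the graph would make that element redundant.

Suppose the binomial of `u` is in a reduced Gröbner basis. Reducedness forces `u⁺` and `u⁻` to
precede every other fiber vector that shares a coordinate with them
(`IsReducedGroebnerBasis.lt_of_common_coordinate`). A nontrivial convex combination equal to one of
them could be taken with rational weights and, after clearing denominators, would contradict the
order (`weight_eq_zero_of_forall_lt`). So both are vertices.

Conversely, choose linear functionals exposing the two vertices. Because the supports of the two
components are disjoint, these glue to one weight; the grading makes it nonnegative and puts `u⁻`
below the whole fiber (`exists_nonneg_weight`). For the resulting term order `u⁻` is standard and
`u⁺` is a minimal nonstandard exponent (`minimal_isNonstandard`), so their difference is in the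
explicit reduced Gröbner basis `reducedBasis`. -/

theorem mem_kerLattice_sub_iff (A : Matrix (Fin m) (Fin n) ℤ) (x y : Fin n → ℤ) :
    x - y ∈ kerLattice A ↔ A.mulVec x = A.mulVec y := by
  simp [kerLattice, Matrix.mulVec_sub, sub_eq_zero]

theorem toInt_add (v w : Fin n → ℕ) : toInt (v + w) = toInt v + toInt w := by
  funext i; simp [toInt]

theorem toInt_injective : Function.Injective (toInt (n := n)) := by
  intro v w h
  funext i
  simpa [toInt] using congrFun h i

theorem toReal_injective : Function.Injective (toReal (n := n)) := by
  intro v w h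
  funext i
  simpa [toReal] using congrFun h i

theorem mulVec_posVec_eq (A : Matrix (Fin m) (Fin n) ℤ) {u : Fin n → ℤ} (hu : u ∈ kerLattice A) :
    A.mulVec (toInt (posVec u)) = A.mulVec (toInt (negVec u)) := by
  rw [← mem_kerLattice_sub_iff, toInt_posVec_sub_toInt_negVec]
  exact hu

theorem mem_fiber_iff (A : Matrix (Fin m) (Fin n) ℤ) (u : Fin n → ℤ) (t : Fin n → ℕ) :
    t ∈ fiber A u ↔ A.mulVec (toInt t) = A.mulVec (toInt (posVec u)) := by
  rw [eq_comm, ← mem_kerLattice_sub_iff]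
  rfl

/-- Two comparable vectors in the same fiber of a positive lattice are equal. -/
theorem eq_of_le_of_mulVec_eq {A : Matrix (Fin m) (Fin n) ℤ}
    (hA : IsPositiveLattice (kerLattice A)) {v w : Fin n → ℕ} (hle : v ≤ w)
    (h : A.mulVec (toInt v) = A.mulVec (toInt w)) : v = w := by
  have h1 : toInt w - toInt v ∈ {v : Fin n → ℤ | v ∈ kerLattice A ∧ 0 ≤ v} := by
    refine ⟨(mem_kerLattice_sub_iff A _ _).2 h.symm, fun i => ?_⟩
    have : v i ≤ w i := hle i
    simp only [toInt, Pi.zero_apply, Pi.sub_apply]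
    omega
  rw [hA, Set.mem_singleton_iff, sub_eq_zero] at h1
  exact (toInt_injective h1).symm

end Basic

/-! ### Walks in fibers and minimal Markov bases -/

section Walks

variable {m n : ℕ}

/-- One step by an element of `M` or the negative of one. -/
def Step (M : Set (Fin n → ℤ)) (a b : Fin n → ℕ) : Prop :=
  toInt b - toInt a ∈ M ∨ -(toInt b - toInt a) ∈ M

theorem Step.symm {M : Set (Fin n → ℤ)} {a b : Fin n → ℕ} (h : Step M a b) : Step M b a := by
  unfold Step at *
  rw [neg_sub] at *
  exact h.symm

theorem Step.add_right {M : Set (Fin n → ℤ)} {a b : Fin n → ℕ} (h : Step M a b)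
    (c : Fin n → ℕ) : Step M (a + c) (b + c) := by
  unfold Step at *
  rwa [toInt_add, toInt_add, add_sub_add_right_eq_sub]

/-- The partial sums of a walk are exactly its vertices, so walks can be composed, reversed and
translated as chains of single steps. -/
theorem connects_iff_reflTransGen (M : Set (Fin n → ℤ)) (w u : Fin n → ℕ) :
    Connects M w u ↔ Relation.ReflTransGen (Step M) w u := by
  constructor
  · rintro ⟨s, v, hv, hpos, hend⟩
    induction s generalizing u with
    | zero =>
      have : w = u := toInt_injective (by simpa using hend)
      rw [this]
    | succ s ih =>
      obtain ⟨t, ht⟩ : ∃ t : Fin n → ℕ, toInt w + ∑ i ∈ Finset.range s, v i = toInt t := by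
        refine ⟨fun i => ((toInt w + ∑ i ∈ Finset.range s, v i) i).toNat, ?_⟩
        funext i
        exact (Int.toNat_of_nonneg (hpos s (by omega) i)).symm
      refine (ih t (fun i hi => hv i (by omega)) (fun p hp => hpos p (by omega)) ht).tail ?_
      have : toInt u - toInt t = v s := by
        rw [← hend, ← ht, Finset.sum_range_succ]; abel
      unfold Step
      rw [this]
      exact hv s (by omega)
  · intro h
    induction h with
    | refl => exact ⟨0, fun _ => 0, by simp, by
        intro p hp i; simp [Nat.le_zero.1 hp, toInt], by simp⟩
    | @tail b c _ hbc ih =>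
      obtain ⟨s, v, hv, hpos, hend⟩ := ih
      have key : ∀ p ≤ s, ∑ i ∈ Finset.range p, Function.update v s (toInt c - toInt b) i =
          ∑ i ∈ Finset.range p, v i := fun p hp => Finset.sum_congr rfl fun i hi => by
        rw [Function.update_of_ne]
        have := Finset.mem_range.1 hi
        omega
      have last : toInt w + ∑ i ∈ Finset.range (s + 1),
          Function.update v s (toInt c - toInt b) i = toInt c := by
        rw [Finset.sum_range_succ, key s le_rfl, Function.update_self, ← add_assoc, hend]
        abel
      refine ⟨s + 1, Function.update v s (toInt c - toInt b), ?_, ?_, last⟩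
      · intro i hi
        rcases Nat.lt_succ_iff_lt_or_eq.1 hi with h | rfl
        · rw [Function.update_of_ne h.ne]
          exact hv i h
        · rw [Function.update_self]
          exact hbc
      · intro p hp
        rcases Nat.le_succ_iff.1 hp with h | rfl
        · rw [key p h]
          exact hpos p h
        · rw [last]
          intro i
          simp [toInt]

theorem reflTransGen_add_right {M : Set (Fin n → ℤ)} {a b : Fin n → ℕ}
    (h : Relation.ReflTransGen (Step M) a b) (c : Fin n → ℕ) :
    Relation.ReflTransGen (Step M) (a + c) (b + c) :=
  h.lift (· + c) fun _ _ hab => hab.add_right c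

theorem reflTransGen_step_symm {M : Set (Fin n → ℤ)} {a b : Fin n → ℕ}
    (h : Relation.ReflTransGen (Step M) a b) : Relation.ReflTransGen (Step M) b a :=
  have : Std.Symm (Step M) := ⟨fun _ _ hab => hab.symm⟩
  symm h

/-- A step by `u` starts above `u⁻` and ends the same distance above `u⁺`. -/
theorem exists_add_of_toInt_sub_eq {u : Fin n → ℤ} {a b : Fin n → ℕ}
    (h : toInt b - toInt a = u) : ∃ c, a = negVec u + c ∧ b = posVec u + c := by
  refine ⟨a - negVec u, ?_, ?_⟩ <;> funext i <;> have := congrFun h i <;>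
    simp only [toInt, Pi.sub_apply, Pi.add_apply, negVec, posVec] at * <;> omega

theorem Step.eq_or_eq_or_diff {M : Set (Fin n → ℤ)} {v u : Fin n → ℤ} (hv : v = u ∨ v = -u)
    {a b : Fin n → ℕ} (h : Step M a b) :
    Step (M \ {v}) a b ∨ toInt b - toInt a = u ∨ toInt a - toInt b = u := by
  by_cases h1 : toInt b - toInt a = u
  · exact Or.inr (Or.inl h1)
  by_cases h2 : toInt a - toInt b = u
  · exact Or.inr (Or.inr h2)
  left
  unfold Step at *
  rw [neg_sub] at *
  have h3 : -(toInt a - toInt b) ≠ -u := fun h => h2 (neg_injective h)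
  have h4 : -(toInt b - toInt a) ≠ -u := fun h => h1 (neg_injective h)
  rw [neg_sub] at h3 h4
  refine h.imp (fun h => ⟨h, ?_⟩) (fun h => ⟨h, ?_⟩) <;>
  · rw [Set.mem_singleton_iff]
    rcases hv with rfl | rfl <;> assumption

/-- Walks in a fiber that becomes the fiber of `u` after adding a nonzero vector do not use `u`. -/
theorem reflTransGen_diff_of_add {A : Matrix (Fin m) (Fin n) ℤ}
    (hA : IsPositiveLattice (kerLattice A)) {M : Set (Fin n → ℤ)}
    (hM : ∀ x ∈ M, x ∈ kerLattice A) {u v : Fin n → ℤ} (hu : u ∈ kerLattice A)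
    (hv : v = u ∨ v = -u) {e : Fin n → ℕ} (he : e ≠ 0) {s t : Fin n → ℕ} (hs : s + e ∈ fiber A u)
    (h : Relation.ReflTransGen (Step M) s t) :
    Relation.ReflTransGen (Step (M \ {v})) s t ∧ t + e ∈ fiber A u := by
  have hker := mulVec_posVec_eq A hu
  induction h with
  | refl => exact ⟨.refl, hs⟩
  | @tail a b _ hab ih =>
    obtain ⟨ih1, ih2⟩ := ih
    rw [mem_fiber_iff] at ih2
    refine ⟨ih1.tail ?_, ?_⟩
    · rcases hab.eq_or_eq_or_diff hv with h | h | h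
      · exact h
      -- A step by `u` from `a = u⁻ + c` puts both `u⁻` and `u⁻ + c + e` in one fiber, and the
      -- antichain property gives `e = 0`. The reverse step is excluded in the same way with `u⁺`.
      · obtain ⟨c, rfl, -⟩ := exists_add_of_toInt_sub_eq h
        rw [hker, add_assoc] at ih2
        have := eq_of_le_of_mulVec_eq hA le_self_add ih2.symm
        simp [he] at this
      · obtain ⟨c, -, rfl⟩ := exists_add_of_toInt_sub_eq h
        rw [add_assoc] at ih2
        have := eq_of_le_of_mulVec_eq hA le_self_add ih2.symm
        simp [he] at this
    · have hd : toInt b - toInt a ∈ kerLattice A := by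
        rcases hab with h | h
        · exact hM _ h
        · exact neg_mem_iff.1 (hM _ h)
      rw [mem_kerLattice_sub_iff] at hd
      rw [mem_fiber_iff, ← ih2, toInt_add, toInt_add, Matrix.mulVec_add, Matrix.mulVec_add, hd]

theorem posVec_mem_fiber (A : Matrix (Fin m) (Fin n) ℤ) (u : Fin n → ℤ) :
    posVec u ∈ fiber A u := (mem_fiber_iff A u _).2 rfl

theorem negVec_mem_fiber (A : Matrix (Fin m) (Fin n) ℤ) {u : Fin n → ℤ} (hu : u ∈ kerLattice A) :
    negVec u ∈ fiber A u := (mem_fiber_iff A u _).2 (mulVec_posVec_eq A hu).symm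

/-- Lower both vectors by one in a shared coordinate `i`. They stay in a common fiber, whose walks
cannot use `±u`; adding the unit vector back gives the required walk. -/
theorem reflTransGen_of_adj {A : Matrix (Fin m) (Fin n) ℤ}
    (hA : IsPositiveLattice (kerLattice A)) {M : Finset (Fin n → ℤ)} (hM : IsMarkovBasis A M)
    {u v : Fin n → ℤ} (hu : u ∈ kerLattice A) (hv : v = u ∨ v = -u) {s t : fiber A u}
    (h : (fiberGraph A u).Adj s t) :
    Relation.ReflTransGen (Step ((M : Set (Fin n → ℤ)) \ {v})) s.1 t.1 := by
  obtain ⟨-, i, hsi, hti⟩ := h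
  have split : ∀ w : Fin n → ℕ, w i ≠ 0 → w = (w - Pi.single i 1) + Pi.single i 1 := by
    intro w hw
    funext j
    by_cases hj : j = i
    · subst hj; simp; omega
    · simp [hj]
  have hs := split _ hsi
  have ht := split _ hti
  rw [hs, ht]
  refine reflTransGen_add_right (reflTransGen_diff_of_add hA (fun x hx => hM.1 x hx) hu hv
    (e := Pi.single i 1) (by simp) (hs ▸ s.2) ((connects_iff_reflTransGen _ _ _).1 (hM.2 _ _ ?_))).1 _
  rw [mem_kerLattice_sub_iff]
  have h1 := (mem_fiber_iff A u _).1 s.2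
  rw [← (mem_fiber_iff A u _).1 t.2, hs, ht, toInt_add, toInt_add, Matrix.mulVec_add,
    Matrix.mulVec_add] at h1
  exact add_right_cancel h1

/-- The two ends of an element of a minimal Markov basis lie in different components. -/
theorem not_reachable_of_minimal {A : Matrix (Fin m) (Fin n) ℤ}
    (hA : IsPositiveLattice (kerLattice A)) {M : Finset (Fin n → ℤ)}
    (hM : IsMinimalMarkovBasis A M) {u v : Fin n → ℤ} (hu : u ∈ kerLattice A)
    (hv : v = u ∨ v = -u) (hvM : v ∈ M) :
    ¬ (fiberGraph A u).Reachable ⟨posVec u, posVec_mem_fiber A u⟩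
      ⟨negVec u, negVec_mem_fiber A hu⟩ := by
  classical
  intro hr
  have hend : Relation.ReflTransGen (Step ((M : Set (Fin n → ℤ)) \ {v})) (posVec u) (negVec u) := by
    rw [SimpleGraph.reachable_iff_reflTransGen] at hr
    have : ∀ x y : fiber A u, Relation.ReflTransGen (fiberGraph A u).Adj x y →
        Relation.ReflTransGen (Step ((M : Set (Fin n → ℤ)) \ {v})) x.1 y.1 := by
      intro x y h
      induction h with
      | refl => exact .refl
      | tail _ hab ih => exact ih.trans (reflTransGen_of_adj hA hM.1 hu hv hab)
    exact this _ _ hr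
  refine hM.2 (M.erase v) (Finset.erase_ssubset hvM) ⟨fun x hx => hM.1.1 x (Finset.mem_of_mem_erase hx),
    fun w t hwt => ?_⟩
  rw [connects_iff_reflTransGen, Finset.coe_erase]
  have h := (connects_iff_reflTransGen _ _ _).1 (hM.1.2 w t hwt)
  clear hwt
  induction h with
  | refl => exact .refl
  | @tail a b _ hab ih =>
    refine ih.trans ?_
    -- Each step by `±u` is replaced by a translate of the detour `hend`, run in the appropriate
    -- direction.
    rcases hab.eq_or_eq_or_diff hv with h | h | h
    · exact .single h
    · obtain ⟨c, rfl, rfl⟩ := exists_add_of_toInt_sub_eq h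
      exact reflTransGen_add_right (reflTransGen_step_symm hend) c
    · obtain ⟨c, rfl, rfl⟩ := exists_add_of_toInt_sub_eq h
      exact reflTransGen_add_right hend c

theorem mem_kerLattice_of_mem_universalMarkovBasis {A : Matrix (Fin m) (Fin n) ℤ} {u : Fin n → ℤ}
    (hu : u ∈ universalMarkovBasis A) : u ∈ kerLattice A := by
  obtain ⟨M, hM, -, h | h⟩ := hu
  · exact hM.1.1 _ h
  · exact neg_mem_iff.1 (hM.1.1 _ h)

theorem not_reachable_of_mem_universalMarkovBasis {A : Matrix (Fin m) (Fin n) ℤ}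
    (hA : IsPositiveLattice (kerLattice A)) {u : Fin n → ℤ} (hu : u ∈ universalMarkovBasis A) :
    ¬ (fiberGraph A u).Reachable ⟨posVec u, posVec_mem_fiber A u⟩
      ⟨negVec u, negVec_mem_fiber A (mem_kerLattice_of_mem_universalMarkovBasis hu)⟩ := by
  have hk := mem_kerLattice_of_mem_universalMarkovBasis hu
  obtain ⟨M, hM, -, h | h⟩ := hu
  · exact not_reachable_of_minimal hA hM hk (Or.inl rfl) h
  · exact not_reachable_of_minimal hA hM hk (Or.inr rfl) h

end Walks

/-! ### From real to integer weights; the positive grading -/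

section Rational

/-- Nonnegative real coefficients can be replaced by natural ones with the same support, preserving
all integer linear relations. -/
theorem exists_nat_weights {ι : Type*} [Fintype ι] (a : ι → ℝ) (ha : ∀ i, 0 ≤ a i) :
    ∃ k : ι → ℕ, (∀ i, 0 < a i → 0 < k i) ∧ (∀ i, a i = 0 → k i = 0) ∧
      ∀ z : ι → ℤ, ∑ i, a i * z i = 0 → ∑ i, (k i : ℤ) * z i = 0 := by
  classical
  let V := Submodule.span ℚ (Set.range a)
  have : FiniteDimensional ℚ V := FiniteDimensional.span_of_finite ℚ (Set.finite_range a)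
  let x : ι → V := fun i => ⟨a i, Submodule.subset_span ⟨i, rfl⟩⟩
  let b := Module.finBasis ℚ V
  -- `F r` lists the values at the `a i` of the ℚ-linear map sending the basis vector `b j` to `r
  -- j`. The inclusion of `V` in `ℝ` is `r = b`, which returns `a`.
  let F : (Fin (Module.finrank ℚ V) → ℝ) → ι → ℝ := fun r i => ∑ j, ((b.repr (x i) j : ℚ) : ℝ) * r j
  have hF : F (fun j => (b j : ℝ)) = a := by
    funext i
    have := congrArg (Subtype.val) (b.sum_repr (x i))
    rw [AddSubmonoidClass.coe_finsetSum] at this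
    simpa [F, x, Rat.smul_def] using this
  have hopen : IsOpen {r | ∀ i, 0 < a i → 0 < F r i} := by
    simp only [Set.ofPred_forall]
    refine isOpen_iInter_of_finite fun i => isOpen_iInter_of_finite fun _ => ?_
    exact isOpen_lt continuous_const (by fun_prop)
  have hdense : DenseRange (fun (q : Fin (Module.finrank ℚ V) → ℚ) j => ((q j : ℚ) : ℝ)) :=
    DenseRange.piMap fun _ => Rat.denseRange_cast
  -- Positivity of finitely many values is an open condition on `r`, so it holds at some rational
  -- `q`. The resulting ℚ-linear `φ` preserves every integer relation among the `a i`.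
  obtain ⟨q, hq⟩ := hdense.exists_mem_open hopen ⟨fun j => (b j : ℝ), by
    intro i hi; rwa [hF]⟩
  let φ : V →ₗ[ℚ] ℚ := b.constr ℚ q
  have hφ : ∀ i, ((φ (x i) : ℚ) : ℝ) = F (fun j => ((q j : ℚ) : ℝ)) i := by
    intro i
    simp only [φ, Module.Basis.constr_apply_fintype, F, Module.Basis.equivFun_apply, smul_eq_mul]
    push_cast
    rfl
  have hpos : ∀ i, 0 < a i → 0 < φ (x i) := by
    intro i hi
    have := hq i hi
    rw [← hφ] at this
    exact_mod_cast this
  have hzero : ∀ i, a i = 0 → φ (x i) = 0 := by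
    intro i hi
    have : x i = 0 := Subtype.ext hi
    rw [this, map_zero]
  have hnn : ∀ i, 0 ≤ φ (x i) := fun i => by
    rcases (ha i).lt_or_eq with h | h
    · exact (hpos i h).le
    · exact (hzero i h.symm).ge
  let D : ℕ := ∏ i, (φ (x i)).den
  have hD : 0 < D := Finset.prod_pos fun i _ => (φ (x i)).den_pos
  have hk : ∀ i, ∃ k : ℕ, (k : ℚ) = D * φ (x i) := by
    intro i
    obtain ⟨e, he⟩ := Finset.dvd_prod_of_mem (fun i => (φ (x i)).den) (Finset.mem_univ i)
    refine ⟨e * (φ (x i)).num.toNat, ?_⟩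
    have h1 : (((φ (x i)).num.toNat : ℤ) : ℚ) = (φ (x i)).num := by
      rw [Int.toNat_of_nonneg (Rat.num_nonneg.2 (hnn i))]
    have h2 := Rat.mul_den_eq_num (φ (x i))
    have h3 : (D : ℚ) = (φ (x i)).den * e := by exact_mod_cast he
    push_cast at h1 ⊢
    rw [h1, ← h2, h3]
    ring
  choose k hk using hk
  refine ⟨k, fun i hi => ?_, fun i hi => ?_, fun z hz => ?_⟩
  · have : (0 : ℚ) < k i := by
      rw [hk]
      have := hpos i hi
      positivity
    exact_mod_cast this
  · have : (k i : ℚ) = 0 := by rw [hk, hzero i hi, mul_zero]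
    exact_mod_cast this
  · have h1 : ∑ i, (z i : ℚ) • x i = 0 := by
      apply Subtype.ext
      rw [AddSubmonoidClass.coe_finsetSum]
      simpa [x, Rat.smul_def, mul_comm] using hz
    have h2 := congrArg φ h1
    rw [map_sum, map_zero] at h2
    simp only [map_smul, smul_eq_mul] at h2
    have h3 : (∑ i, (k i : ℚ) * z i) = 0 := by
      calc (∑ i, (k i : ℚ) * z i) = D * ∑ i, (z i : ℚ) * φ (x i) := by
            rw [Finset.mul_sum]
            exact Finset.sum_congr rfl fun i _ => by rw [hk]; ring
        _ = 0 := by rw [h2, mul_zero]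
    exact_mod_cast h3

variable {m n : ℕ}

/-- A positive lattice has a strictly positive real vector that is constant on fibers. -/
theorem exists_pos_grading {A : Matrix (Fin m) (Fin n) ℤ}
    (hA : IsPositiveLattice (kerLattice A)) :
    ∃ p : Fin n → ℝ, (∀ i, 0 < p i) ∧ ∀ v w : Fin n → ℕ, A.mulVec (toInt v) = A.mulVec (toInt w) →
      ∑ i, p i * v i = ∑ i, p i * w i := by
  let L : Submodule ℝ (Fin n → ℝ) := LinearMap.ker (A.map (Int.cast : ℤ → ℝ)).mulVecLin
  -- A nonnegative nonzero real kernel vector would yield a natural one, against positivity.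
  have hdisj : Disjoint (stdSimplex ℝ (Fin n)) (L : Set (Fin n → ℝ)) := by
    rw [Set.disjoint_left]
    rintro x ⟨hx0, hx1⟩ hxL
    obtain ⟨k, hk1, -, hk3⟩ := exists_nat_weights x hx0
    have hk : toInt k ∈ {v : Fin n → ℤ | v ∈ kerLattice A ∧ 0 ≤ v} := by
      refine ⟨?_, fun i => by simp [toInt]⟩
      rw [kerLattice, LinearMap.mem_ker, Matrix.mulVecLin_apply]
      funext j
      have h1 : ∑ i, x i * (A j i : ℝ) = 0 := by
        have := congrFun (show (A.map (Int.cast : ℤ → ℝ)).mulVec x = 0 from hxL) j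
        simpa [Matrix.mulVec, dotProduct, mul_comm] using this
      have := hk3 (fun i => A j i) h1
      simpa [Matrix.mulVec, dotProduct, mul_comm, toInt] using this
    rw [hA, Set.mem_singleton_iff] at hk
    have hx : ∀ i, x i = 0 := by
      intro i
      by_contra h
      have h1 := hk1 i (lt_of_le_of_ne (hx0 i) (Ne.symm h))
      have h2 := congrFun hk i
      simp only [toInt, Pi.zero_apply] at h2
      omega
    simp [hx] at hx1
  obtain ⟨f, s, t, hfs, hst, hft⟩ := geometric_hahn_banach_compact_closed (convex_stdSimplex ℝ (Fin n))
    (isCompact_stdSimplex (𝕜 := ℝ) (Fin n)) L.convex L.closed_of_finiteDimensional hdisj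
  have ht0 : t < 0 := by simpa using hft 0 L.zero_mem
  -- A functional bounded below on a subspace vanishes there; since it is negative on the simplex,
  -- its negative is the grading.
  have hfL : ∀ y ∈ L, f y = 0 := by
    intro y hy
    by_contra h
    have := hft ((t / f y) • y) (L.smul_mem _ hy)
    rw [map_smul, smul_eq_mul, div_mul_cancel₀ _ h] at this
    exact lt_irrefl _ this
  have hfsum : ∀ y : Fin n → ℝ, f y = ∑ i, f (Pi.single i 1) * y i := by
    intro y
    conv_lhs => rw [pi_eq_sum_univ' y]
    rw [map_sum]
    refine Finset.sum_congr rfl fun i _ => ?_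
    rw [map_smul, smul_eq_mul, mul_comm]
  refine ⟨fun i => -f (Pi.single i 1), fun i => ?_, fun v w hvw => ?_⟩
  · have := hfs _ (single_mem_stdSimplex ℝ i)
    linarith
  · have : toReal v - toReal w ∈ L := by
      rw [LinearMap.mem_ker, Matrix.mulVecLin_apply]
      funext j
      have h1 := congrFun hvw j
      simp only [Matrix.mulVec, dotProduct, toInt] at h1
      have h2 : (∑ i, (A j i : ℝ) * v i) = ∑ i, (A j i : ℝ) * w i := by exact_mod_cast h1
      simp [Matrix.mulVec, dotProduct, toReal, mul_sub, h2]
    have h2 := hfL _ this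
    rw [map_sub, hfsum, hfsum (toReal w), sub_eq_zero] at h2
    simpa [toReal] using h2

/-- A fiber is an antichain in `ℕⁿ`, hence finite by Dickson's lemma. -/
theorem fiber_finite {A : Matrix (Fin m) (Fin n) ℤ} (hA : IsPositiveLattice (kerLattice A))
    (u : Fin n → ℤ) : (fiber A u).Finite := by
  refine WellQuasiOrderedLE.finite_of_isAntichain fun v hv w hw hne hle => hne ?_
  rw [mem_fiber_iff] at hv hw
  exact eq_of_le_of_mulVec_eq hA hle (hv.trans hw.symm)

end Rational

open MvPolynomial

variable {m n : ℕ}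

/-- A vector of `ℕⁿ` seen as the exponent of a monomial. -/
noncomputable abbrev expo (w : Fin n → ℕ) : Fin n →₀ ℕ := Finsupp.equivFunOnFinite.symm w

theorem expo_add (v w : Fin n → ℕ) : expo (v + w) = expo v + expo w := by
  ext i; simp

/-! ### Binomials in reduced Gröbner bases -/

section Groebner

variable {K : Type*} [Field K]

theorem xpow_sub_mem_latticeIdeal {A : Matrix (Fin m) (Fin n) ℤ} {v w : Fin n → ℕ}
    (h : A.mulVec (toInt v) = A.mulVec (toInt w)) : xpow K v - xpow K w ∈ latticeIdeal K A :=
  Ideal.subset_span ⟨v, w, h, rfl⟩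

theorem degree_xpow (ord : MonomialOrder (Fin n)) (v : Fin n → ℕ) :
    ord.degree (xpow K v) = expo v := by
  classical
  rw [xpow, ord.degree_monomial, if_neg one_ne_zero]

theorem degree_xpow_sub (ord : MonomialOrder (Fin n)) {v w : Fin n → ℕ}
    (h : ord.toSyn (expo w) < ord.toSyn (expo v)) :
    ord.degree (xpow K v - xpow K w) = expo v := by
  rw [ord.degree_sub_of_lt (by rwa [degree_xpow, degree_xpow]), degree_xpow]

theorem monic_xpow_sub (ord : MonomialOrder (Fin n)) {v w : Fin n → ℕ}
    (h : ord.toSyn (expo w) < ord.toSyn (expo v)) :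
    ord.Monic (xpow K v - xpow K w) := by
  rw [MonomialOrder.Monic, ord.leadingCoeff_sub_of_lt (by rwa [degree_xpow, degree_xpow]), xpow,
    ord.leadingCoeff_monomial]

theorem support_xpow_sub {v w : Fin n → ℕ} (h : v ≠ w) :
    (xpow K v - xpow K w).support = {expo v, expo w} := by
  classical
  have h' : expo v ≠ expo w := fun e => h (Finsupp.equivFunOnFinite.symm.injective e)
  ext d
  rw [mem_support_iff, coeff_sub, xpow, xpow, coeff_monomial, coeff_monomial]
  rw [Finset.mem_insert, Finset.mem_singleton]
  by_cases h1 : expo v = d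
  · subst h1
    simp [h'.symm]
  · by_cases h2 : expo w = d
    · subst h2
      simp [h']
    · simp [h1, h2, Ne.symm h1, Ne.symm h2]

theorem span_leadingTerm_image_of_monic (ord : MonomialOrder (Fin n))
    {G : Set (MvPolynomial (Fin n) K)} (hG : ∀ g ∈ G, ord.Monic g) :
    ord.leadingTerm '' G = (fun d => monomial d (1 : K)) '' (ord.degree '' G) := by
  rw [Set.image_image]
  refine Set.image_congr fun g hg => ?_
  rw [MonomialOrder.leadingTerm, (hG g hg).leadingCoeff_eq_one]

/-- Every nonzero element of an ideal has its leading monomial divisible by that of an element of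
a reduced Gröbner basis. -/
theorem IsReducedGroebnerBasis.exists_degree_le {ord : MonomialOrder (Fin n)}
    {I : Ideal (MvPolynomial (Fin n) K)} {G : Set (MvPolynomial (Fin n) K)}
    (hG : IsReducedGroebnerBasis ord I G) {f : MvPolynomial (Fin n) K} (hf : f ∈ I) (hf0 : f ≠ 0) :
    ∃ g ∈ G, ord.degree g ≤ ord.degree f := by
  obtain ⟨-, -, hspan, hmonic, -⟩ := hG
  have h1 : ord.leadingTerm f ∈ Ideal.span (ord.leadingTerm '' G) := by
    rw [hspan]
    exact Ideal.subset_span ⟨f, hf, rfl⟩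
  rw [span_leadingTerm_image_of_monic ord hmonic, mem_ideal_span_monomial_image] at h1
  obtain ⟨_, ⟨g, hg, rfl⟩, hle⟩ := h1 (ord.degree f) (by
    rw [ord.support_leadingTerm' hf0]; exact Finset.mem_singleton_self _)
  exact ⟨g, hg, hle⟩

/-- If a binomial lies in a reduced Gröbner basis, then each of its two exponents precedes all
vectors of the fiber that share a nonzero coordinate with it. -/
theorem IsReducedGroebnerBasis.lt_of_common_coordinate {A : Matrix (Fin m) (Fin n) ℤ}
    (hA : IsPositiveLattice (kerLattice A)) {ord : MonomialOrder (Fin n)}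
    {G : Set (MvPolynomial (Fin n) K)} (hG : IsReducedGroebnerBasis ord (latticeIdeal K A) G)
    {v w : Fin n → ℕ} (hvw : A.mulVec (toInt v) = A.mulVec (toInt w)) (hne : v ≠ w)
    (hmem : xpow K v - xpow K w ∈ G) {d : Fin n → ℕ} (hd : d = v ∨ d = w) {t : Fin n → ℕ}
    (ht : A.mulVec (toInt t) = A.mulVec (toInt d)) (htd : t ≠ d) {i : Fin n} (hti : t i ≠ 0)
    (hdi : d i ≠ 0) : ord.toSyn (expo d) < ord.toSyn (expo t) := by
  by_contra hlt
  have hlt : ord.toSyn (expo t) < ord.toSyn (expo d) := lt_of_le_of_ne (not_lt.1 hlt) fun h =>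
    htd (Finsupp.equivFunOnFinite.symm.injective (ord.toSyn.injective h))
  have split : ∀ w : Fin n → ℕ, w i ≠ 0 → ∃ w' : Fin n → ℕ, w = w' + Pi.single i 1 := by
    intro w hw
    refine ⟨w - Pi.single i 1, ?_⟩
    funext j
    by_cases hj : j = i
    · subst hj; simp; omega
    · simp [hj]
  obtain ⟨t', rfl⟩ := split t hti
  obtain ⟨d', rfl⟩ := split d hdi
  rw [expo_add, expo_add, map_add, map_add, add_lt_add_iff_right] at hlt
  rw [toInt_add, toInt_add, Matrix.mulVec_add, Matrix.mulVec_add, add_left_inj] at ht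
  -- Some leading monomial of `G` divides `x^{d'}`, hence properly divides the term `x^{d' + e_i}`
  -- of the given binomial. If `g` is that binomial, the antichain property fails; otherwise
  -- reducedness fails.
  obtain ⟨g, hg, hle⟩ := hG.exists_degree_le (xpow_sub_mem_latticeIdeal (K := K) ht.symm)
    (monic_xpow_sub ord hlt).ne_zero
  rw [degree_xpow_sub ord hlt] at hle
  have hle' : expo d' ≤ expo (d' + Pi.single i 1) := by rw [expo_add]; exact le_self_add
  have hsupp := support_xpow_sub (K := K) hne
  by_cases hgb : g = xpow K v - xpow K w
  · have hD := ord.degree_mem_support (hG.2.2.2.1 g hg).ne_zero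
    rw [hgb, hsupp, Finset.mem_insert, Finset.mem_singleton, ← hgb] at hD
    obtain ⟨D, hDg, hDvw⟩ : ∃ D, ord.degree g = expo D ∧ (D = v ∨ D = w) := by
      rcases hD with h | h
      · exact ⟨v, h, Or.inl rfl⟩
      · exact ⟨w, h, Or.inr rfl⟩
    rw [hDg] at hle
    have hle1 : D ≤ d' := hle
    have hfib : A.mulVec (toInt D) = A.mulVec (toInt (d' + Pi.single i 1)) := by
      rcases hDvw with rfl | rfl <;> rcases hd with h | h <;> rw [h] <;> simp [hvw]
    have h1 := eq_of_le_of_mulVec_eq hA (hle1.trans le_self_add) hfib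
    rw [h1] at hle1
    have := hle1 i
    simp at this
  · refine hG.2.2.2.2 _ hmem g hg hgb (expo (d' + Pi.single i 1)) ?_ (hle.trans hle')
    rw [hsupp, Finset.mem_insert, Finset.mem_singleton]
    rcases hd with h | h <;> simp [h]

end Groebner

/-! ### Order-minimal vectors are vertices -/

section Extreme

theorem mem_convexHull_toReal_image {S : Set (Fin n → ℕ)} (hS : S.Finite) {x : Fin n → ℝ} :
    x ∈ convexHull ℝ (toReal '' S) ↔ ∃ a : (Fin n → ℕ) → ℝ, (∀ t ∈ hS.toFinset, 0 ≤ a t) ∧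
      ∑ t ∈ hS.toFinset, a t = 1 ∧ ∑ t ∈ hS.toFinset, a t • toReal t = x := by
  classical
  have himg : toReal '' S = ((hS.toFinset.image toReal : Finset (Fin n → ℝ)) : Set _) := by simp
  rw [himg, Finset.mem_convexHull']
  constructor
  · rintro ⟨w, h0, h1, h2⟩
    rw [Finset.sum_image toReal_injective.injOn] at h1 h2
    exact ⟨w ∘ toReal, fun t ht => h0 _ (Finset.mem_image_of_mem _ ht), h1, h2⟩
  · rintro ⟨a, h0, h1, h2⟩
    have hinv : ∀ t, a (Function.invFun toReal (toReal t)) = a t := fun t => by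
      rw [Function.leftInverse_invFun toReal_injective]
    refine ⟨a ∘ Function.invFun toReal, ?_, ?_, ?_⟩
    · intro y hy
      obtain ⟨t, ht, rfl⟩ := Finset.mem_image.1 hy
      simpa [hinv] using h0 t ht
    · rw [Finset.sum_image toReal_injective.injOn]
      simpa [hinv] using h1
    · rw [Finset.sum_image toReal_injective.injOn]
      simpa [hinv] using h2

/-- If `d` precedes, in a monomial order, all vectors of `S` with support in that of `d`, then `d`
is only the trivial convex combination of vectors of `S`. -/
theorem weight_eq_zero_of_forall_lt (ord : MonomialOrder (Fin n)) (T : Finset (Fin n → ℕ))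
    {d : Fin n → ℕ}
    (hlt : ∀ t ∈ T, t ≠ d → (∀ i, d i = 0 → t i = 0) → ord.toSyn (expo d) < ord.toSyn (expo t))
    {c : (Fin n → ℕ) → ℝ} (hc0 : ∀ t ∈ T, 0 ≤ c t) (hc1 : ∑ t ∈ T, c t = 1)
    (hc : ∑ t ∈ T, c t • toReal t = toReal d) : ∀ t ∈ T, t ≠ d → c t = 0 := by
  classical
  have hcoord : ∀ i, ∑ t ∈ T, c t * (t i : ℝ) = d i := by
    intro i
    have := congrFun hc i
    simpa [toReal, Finset.sum_apply] using this
  -- The weight at `d` can be dropped because it contributes nothing to `∑ c t • (t - d) = 0`.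
  let c' : T → ℝ := fun t => if t.1 = d then 0 else c t.1
  have hc'0 : ∀ t, 0 ≤ c' t := by
    intro t
    simp only [c']
    split_ifs
    · exact le_rfl
    · exact hc0 _ t.2
  obtain ⟨k, hk1, hk2, hk3⟩ := exists_nat_weights c' hc'0
  have hrel : ∀ i, ∑ t, (k t : ℤ) * ((t.1 i : ℤ) - d i) = 0 := by
    intro i
    apply hk3 (fun t => (t.1 i : ℤ) - d i)
    have h1 : ∀ t : T, c' t * (((t.1 i : ℤ) - d i : ℤ) : ℝ) = c t.1 * (t.1 i : ℝ) - c t.1 * d i := by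
      intro t
      simp only [c']
      split_ifs with h
      · rw [h]; ring
      · push_cast; ring
    rw [Finset.sum_congr rfl fun t _ => h1 t, Finset.sum_coe_sort T
      (fun t => c t * (t i : ℝ) - c t * d i), Finset.sum_sub_distrib, hcoord, ← Finset.sum_mul, hc1]
    ring
  have hsum : ∑ t, k t • expo t.1 = ∑ t, k t • expo d := by
    ext i
    have := hrel i
    simp only [mul_sub, Finset.sum_sub_distrib, sub_eq_zero] at this
    simp only [Finsupp.finsetSum_apply, Finsupp.smul_apply, smul_eq_mul,
      Finsupp.equivFunOnFinite_symm_apply_apply]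
    exact_mod_cast this
  have hlt' : ∀ t : T, 0 < k t → ord.toSyn (expo d) < ord.toSyn (expo t.1) := by
    intro t ht
    have hne : c' t ≠ 0 := fun h => ht.ne' (hk2 t h)
    have htd : t.1 ≠ d := fun h => hne (if_pos h)
    refine hlt _ t.2 htd fun i hi => ?_
    -- Where `d` vanishes, a sum of nonnegative terms is zero, so every `t` with positive weight
    -- vanishes there too.
    have h1 := hcoord i
    rw [hi, Nat.cast_zero, Finset.sum_eq_zero_iff_of_nonneg fun t ht =>
      mul_nonneg (hc0 t ht) (Nat.cast_nonneg _)] at h1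
    have h2 := h1 t.1 t.2
    have h3 : c t.1 ≠ 0 := by simpa [c', htd] using hne
    simpa [h3] using h2
  intro t ht htd
  by_contra hct
  have hkt : 0 < k ⟨t, ht⟩ := hk1 _ (by
    simp only [c', if_neg htd]
    exact lt_of_le_of_ne (hc0 t ht) (Ne.symm hct))
  have h1 := congrArg ord.toSyn hsum
  rw [map_sum, map_sum] at h1
  simp only [map_nsmul] at h1
  refine h1.not_gt (Finset.sum_lt_sum (fun s _ => ?_) ⟨⟨t, ht⟩, Finset.mem_univ _, ?_⟩)
  · rcases Nat.eq_zero_or_pos (k s) with h | h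
    · simp [h]
    · exact nsmul_le_nsmul_right (hlt' s h).le _
  · exact nsmul_lt_nsmul_right hkt.ne' (hlt' _ hkt)

/-- If `d` lies strictly between two points of the hull, their convex weights merge into one
representation of `d`. As that one is trivial, both points equal `d`. -/
theorem toReal_mem_extremePoints_of_forall_lt (ord : MonomialOrder (Fin n))
    {S : Set (Fin n → ℕ)} (hS : S.Finite) {d : Fin n → ℕ} (hd : d ∈ S)
    (hlt : ∀ t ∈ S, t ≠ d → (∀ i, d i = 0 → t i = 0) → ord.toSyn (expo d) < ord.toSyn (expo t)) :
    toReal d ∈ Set.extremePoints ℝ (convexHull ℝ (toReal '' S)) := by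
  rw [mem_extremePoints_iff_left]
  refine ⟨subset_convexHull ℝ _ ⟨d, hd, rfl⟩, ?_⟩
  rintro x hx y hy ⟨α, β, hα, hβ, hαβ, hxy⟩
  obtain ⟨a, ha0, ha1, rfl⟩ := (mem_convexHull_toReal_image hS).1 hx
  obtain ⟨b, hb0, hb1, rfl⟩ := (mem_convexHull_toReal_image hS).1 hy
  have key := weight_eq_zero_of_forall_lt ord hS.toFinset (d := d) (c := fun t => α * a t + β * b t)
    (fun t ht => hlt t (hS.mem_toFinset.1 ht))
    (fun t ht => add_nonneg (mul_nonneg hα.le (ha0 t ht)) (mul_nonneg hβ.le (hb0 t ht)))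
    (by rw [Finset.sum_add_distrib, ← Finset.mul_sum, ← Finset.mul_sum, ha1, hb1]; linarith)
    (by
      rw [← hxy, Finset.smul_sum, Finset.smul_sum, ← Finset.sum_add_distrib]
      exact Finset.sum_congr rfl fun t _ => by rw [add_smul, mul_smul, mul_smul])
  have ha : ∀ t ∈ hS.toFinset, t ≠ d → a t = 0 := by
    intro t ht htd
    have h1 := key t ht htd
    have h2 := mul_nonneg hα.le (ha0 t ht)
    have h3 := mul_nonneg hβ.le (hb0 t ht)
    have h4 : α * a t = 0 := by linarith
    exact (mul_eq_zero.1 h4).resolve_left hα.ne'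
  have hd' : d ∈ hS.toFinset := hS.mem_toFinset.2 hd
  rw [Finset.sum_eq_single_of_mem d hd' ha] at ha1
  rw [Finset.sum_eq_single_of_mem d hd' fun t ht htd => by rw [ha t ht htd, zero_smul], ha1, one_smul]

end Extreme

/-! ### Components of the fiber graph -/

section Components

variable {A : Matrix (Fin m) (Fin n) ℤ} {u : Fin n → ℤ}

/-- Vectors in different components of the graph of a fiber have disjoint supports. -/
theorem eq_zero_of_ne_component {C D : (fiberGraph A u).ConnectedComponent} (hCD : C ≠ D)
    {w t : fiber A u} (hw : w ∈ C.supp) (ht : t ∈ D.supp) {i : Fin n} (hi : w.1 i ≠ 0) :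
    t.1 i = 0 := by
  by_contra h
  rw [SimpleGraph.ConnectedComponent.mem_supp_iff] at hw ht
  refine hCD ?_
  rw [← hw, ← ht]
  by_cases hwt : w = t
  · rw [hwt]
  · exact SimpleGraph.ConnectedComponent.connectedComponentMk_eq_of_adj ⟨hwt, i, hi, h⟩

/-- For `i` in the support of `w`, the hull of `D` lies in the hyperplane `x_i = 0`, which misses
`w`. -/
theorem convexHull_component_ne {C D : (fiberGraph A u).ConnectedComponent} (hCD : C ≠ D)
    {w : fiber A u} (hw : w ∈ C.supp) (hw0 : w.1 ≠ 0) :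
    convexHull ℝ ((fun w : fiber A u => toReal w.1) '' C.supp) ≠
      convexHull ℝ ((fun w : fiber A u => toReal w.1) '' D.supp) := by
  obtain ⟨i, hi⟩ := Function.ne_iff.1 hw0
  intro h
  have h1 : toReal w.1 ∈ convexHull ℝ ((fun w : fiber A u => toReal w.1) '' C.supp) :=
    subset_convexHull ℝ _ ⟨w, hw, rfl⟩
  rw [h] at h1
  have h2 : convexHull ℝ ((fun w : fiber A u => toReal w.1) '' D.supp) ⊆
      (LinearMap.ker (LinearMap.proj i : (Fin n → ℝ) →ₗ[ℝ] ℝ) : Set (Fin n → ℝ)) := by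
    refine convexHull_min ?_ (Submodule.convex _)
    rintro _ ⟨t, ht, rfl⟩
    have := eq_zero_of_ne_component hCD hw ht hi
    simp [toReal, this]
  have h3 := h2 h1
  simp only [SetLike.mem_coe, LinearMap.mem_ker, LinearMap.proj_apply, toReal] at h3
  exact hi (by exact_mod_cast h3)

/-- A fiber vector other than `d` is nonzero, since `0 ≤ d`. So if its support lies in that of `d`,
the two share a coordinate and the order comparison applies. -/
theorem toReal_mem_extremePoints_of_mem_groebner {K : Type*} [Field K]
    (hA : IsPositiveLattice (kerLattice A)) (hu : u ∈ kerLattice A) (hne : posVec u ≠ negVec u)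
    {ord : MonomialOrder (Fin n)} {G : Set (MvPolynomial (Fin n) K)}
    (hG : IsReducedGroebnerBasis ord (latticeIdeal K A) G)
    (hmem : xpow K (posVec u) - xpow K (negVec u) ∈ G) {d : fiber A u}
    (hd : d.1 = posVec u ∨ d.1 = negVec u) {C : (fiberGraph A u).ConnectedComponent}
    (hdC : d ∈ C.supp) :
    toReal d.1 ∈ Set.extremePoints ℝ
      (convexHull ℝ ((fun w : fiber A u => toReal w.1) '' C.supp)) := by
  rw [← Set.image_image toReal Subtype.val]
  refine toReal_mem_extremePoints_of_forall_lt ord ((fiber_finite hA u).subset ?_) ⟨d, hdC, rfl⟩ ?_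
  · rintro _ ⟨t, -, rfl⟩
    exact t.2
  · rintro _ ⟨t, -, rfl⟩ htd hsupp
    have hfib : A.mulVec (toInt t.1) = A.mulVec (toInt d.1) :=
      ((mem_fiber_iff A u _).1 t.2).trans ((mem_fiber_iff A u _).1 d.2).symm
    have ht0 : t.1 ≠ 0 := by
      intro h
      exact htd (eq_of_le_of_mulVec_eq hA (by rw [h]; exact fun i => Nat.zero_le _) hfib)
    obtain ⟨i, hi⟩ := Function.ne_iff.1 ht0
    exact hG.lt_of_common_coordinate hA (mulVec_posVec_eq A hu) hne hmem hd hfib htd hi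
      (fun h => hi (hsupp i h))

end Components

/-! ### Term orders from nonnegative weights -/

section WeightOrder

variable {n : ℕ}

/-- The exponents, to be ordered by the weight `w` with ties broken lexicographically. -/
def WeightSyn (_w : Fin n → ℝ) : Type := Fin n →₀ ℕ

noncomputable instance (w : Fin n → ℝ) : AddCommMonoid (WeightSyn w) :=
  inferInstanceAs (AddCommMonoid (Fin n →₀ ℕ))

/-- The weight of an exponent paired with the exponent itself. -/
noncomputable def weightLex (w : Fin n → ℝ) (a : Fin n →₀ ℕ) : ℝ ×ₗ Lex (Fin n →₀ ℕ) :=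
  toLex (∑ i, w i * a i, toLex a)

theorem weightLex_add (w : Fin n → ℝ) (a b : Fin n →₀ ℕ) :
    weightLex w (a + b) = weightLex w a + weightLex w b := by
  have : ∑ i, w i * ((a + b) i : ℝ) = ∑ i, w i * a i + ∑ i, w i * b i := by
    rw [← Finset.sum_add_distrib]
    exact Finset.sum_congr rfl fun i _ => by rw [Finsupp.add_apply]; push_cast; ring
  rw [weightLex, this]
  rfl

theorem weightLex_injective (w : Fin n → ℝ) : Function.Injective (weightLex w) := by
  intro a b h
  have := congrArg (fun x => (ofLex x).2) h
  exact this

noncomputable instance (w : Fin n → ℝ) : LinearOrder (WeightSyn w) :=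
  LinearOrder.lift' (fun a : WeightSyn w => weightLex w a) (weightLex_injective w)

theorem weightSyn_le_iff (w : Fin n → ℝ) (a b : WeightSyn w) :
    a ≤ b ↔ weightLex w a ≤ weightLex w b := Iff.rfl

/-- The identity, from exponents to exponents ordered by weight. -/
def toWeightSyn (w : Fin n → ℝ) : (Fin n →₀ ℕ) ≃+ WeightSyn w where
  toFun a := a
  invFun a := a
  map_add' _ _ := rfl

instance (w : Fin n → ℝ) : IsOrderedAddMonoid (WeightSyn w) where
  add_le_add_left a b hab c := by
    rw [weightSyn_le_iff] at *
    have h1 := weightLex_add w a c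
    have h2 := weightLex_add w b c
    exact (h1.le.trans (add_le_add_left hab (weightLex w c))).trans h2.ge

theorem weightLex_monotone {w : Fin n → ℝ} (hw : ∀ i, 0 ≤ w i) : Monotone (weightLex w) := by
  intro a b hab
  refine Prod.Lex.toLex_mono ⟨?_, Finsupp.toLex_monotone hab⟩
  change ∑ i, w i * (a i : ℝ) ≤ ∑ i, w i * (b i : ℝ)
  refine Finset.sum_le_sum fun i _ => mul_le_mul_of_nonneg_left ?_ (hw i)
  exact_mod_cast hab i

theorem toWeightSyn_monotone {w : Fin n → ℝ} (hw : ∀ i, 0 ≤ w i) : Monotone (toWeightSyn w) :=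
  fun _ _ h => (weightSyn_le_iff w _ _).2 (weightLex_monotone hw h)

/-- The monomial order given by a nonnegative weight, with ties broken lexicographically. -/
noncomputable def weightOrder (w : Fin n → ℝ) (hw : ∀ i, 0 ≤ w i) :
    MonomialOrder.{0, 0} (Fin n) where
  syn := WeightSyn w
  toSyn := toWeightSyn w
  toSyn_monotone := toWeightSyn_monotone hw
  wellFoundedLT_syn := by
    have := (toWeightSyn_monotone hw).wellQuasiOrderedLE_of_wellQuasiOrderedLE_of_surjective
      (toWeightSyn w).surjective
    infer_instance

theorem weightOrder_lt {w : Fin n → ℝ} (hw : ∀ i, 0 ≤ w i) {v t : Fin n → ℕ}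
    (h : ∑ i, w i * v i < ∑ i, w i * t i) :
    (weightOrder w hw).toSyn (expo v) < (weightOrder w hw).toSyn (expo t) := by
  have : weightLex w (expo v) < weightLex w (expo t) := Prod.Lex.toLex_lt_toLex.2 (Or.inl h)
  exact lt_of_not_ge fun hle => this.not_ge
    ((weightSyn_le_iff w (toWeightSyn w (expo t)) (toWeightSyn w (expo v))).1 hle)

end WeightOrder

/-! ### The reduced Gröbner basis of a lattice ideal -/

section Existence

variable {m n : ℕ} (A : Matrix (Fin m) (Fin n) ℤ) (ord : MonomialOrder (Fin n))

/-- `a` is not the smallest vector of its fiber. -/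
def IsNonstandard (a : Fin n → ℕ) : Prop :=
  ∃ t : Fin n → ℕ, A.mulVec (toInt t) = A.mulVec (toInt a) ∧
    ord.toSyn (expo t) < ord.toSyn (expo a)

variable {A ord}

theorem IsNonstandard.mono {a b : Fin n → ℕ} (ha : IsNonstandard A ord a) (hab : a ≤ b) :
    IsNonstandard A ord b := by
  obtain ⟨t, ht, hlt⟩ := ha
  obtain ⟨c, rfl⟩ := exists_add_of_le hab
  refine ⟨t + c, ?_, ?_⟩
  · rw [toInt_add, toInt_add, Matrix.mulVec_add, Matrix.mulVec_add, ht]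
  · rw [expo_add, expo_add, map_add, map_add]
    exact add_lt_add_left hlt _

variable (A ord) in
theorem exists_standard (a : Fin n → ℕ) :
    ∃ b, A.mulVec (toInt b) = A.mulVec (toInt a) ∧ ¬ IsNonstandard A ord b := by
  obtain ⟨b, hb, hmin⟩ := (InvImage.wf (fun t : Fin n → ℕ => ord.toSyn (expo t))
    (wellFounded_lt (α := ord.syn))).has_min {t | A.mulVec (toInt t) = A.mulVec (toInt a)} ⟨a, rfl⟩
  exact ⟨b, hb, fun ⟨t, ht, hlt⟩ => hmin t (ht.trans hb) hlt⟩

theorem lt_of_standard {a b : Fin n → ℕ} (hb : ¬ IsNonstandard A ord b)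
    (hab : A.mulVec (toInt a) = A.mulVec (toInt b)) (hne : a ≠ b) :
    ord.toSyn (expo b) < ord.toSyn (expo a) := by
  refine lt_of_le_of_ne (not_lt.1 fun h => hb ⟨a, hab, h⟩) fun h => hne ?_
  exact Finsupp.equivFunOnFinite.symm.injective (ord.toSyn.injective h.symm)

variable {K : Type*} [Field K]

variable (K A) in
/-- The grading of the polynomial ring by `A`, as a map to a group algebra. -/
noncomputable def gradingHom :
    MvPolynomial (Fin n) K →+* AddMonoidAlgebra K (Fin m → ℤ) :=
  AddMonoidAlgebra.mapDomainRingHom K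
    { toFun := fun d : Fin n →₀ ℕ => A.mulVec (toInt d)
      map_zero' := by
        have : toInt (⇑(0 : Fin n →₀ ℕ)) = 0 := by funext i; simp [toInt]
        rw [this, Matrix.mulVec_zero]
      map_add' := fun a b => by rw [Finsupp.coe_add, toInt_add, Matrix.mulVec_add] }

theorem latticeIdeal_le_ker_gradingHom : latticeIdeal K A ≤ RingHom.ker (gradingHom A K) := by
  refine Ideal.span_le.2 ?_
  rintro _ ⟨u, v, huv, rfl⟩
  have hx : ∀ w : Fin n → ℕ, gradingHom A K (xpow K w) =
      AddMonoidAlgebra.single (A.mulVec (toInt w)) 1 := fun w =>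
    AddMonoidAlgebra.mapDomain_single
  rw [SetLike.mem_coe, RingHom.mem_ker, map_sub, hx, hx, huv, sub_self]

/-- On the ideal, the coefficients over each fiber sum to zero. If the leading exponent were
smallest in its fiber, no other term could lie there, and that sum would be the leading coefficient.
-/
theorem isNonstandard_degree {f : MvPolynomial (Fin n) K} (hf : f ∈ latticeIdeal K A)
    (hf0 : f ≠ 0) : IsNonstandard A ord (ord.degree f) := by
  classical
  by_contra h
  have h1 : gradingHom A K f = 0 := latticeIdeal_le_ker_gradingHom hf
  have h2 : (gradingHom A K f).coeff (A.mulVec (toInt (ord.degree f))) = ord.leadingCoeff f := by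
    change (AddMonoidAlgebra.mapDomain (fun d : Fin n →₀ ℕ => A.mulVec (toInt d)) f).coeff _ = _
    rw [AddMonoidAlgebra.coeff_mapDomain, Finsupp.mapDomain, Finsupp.sum_apply, Finsupp.sum,
      Finset.sum_eq_single_of_mem (ord.degree f)
        (s := (AddMonoidAlgebra.coeff f).support) (ord.degree_mem_support hf0)]
    · rw [Finsupp.single_eq_same]
      rfl
    · intro d hd hne
      refine Finsupp.single_eq_of_ne' fun he => ?_
      have h3 := lt_of_standard h he fun h => hne (DFunLike.coe_injective h)
      rw [expo, expo, Finsupp.equivFunOnFinite_symm_coe, Finsupp.equivFunOnFinite_symm_coe] at h3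
      exact (ord.le_degree hd).not_gt h3
  rw [h1] at h2
  exact hf0 (ord.leadingCoeff_eq_zero_iff.1 h2.symm)

variable (K A ord) in
/-- The reduced Gröbner basis of the lattice ideal: each minimal nonstandard vector minus the
smallest vector of its fiber. -/
def reducedBasis : Set (MvPolynomial (Fin n) K) :=
  {g | ∃ a b : Fin n → ℕ, Minimal (IsNonstandard A ord) a ∧
    A.mulVec (toInt b) = A.mulVec (toInt a) ∧ ¬ IsNonstandard A ord b ∧ g = xpow K a - xpow K b}

/-- Minimal nonstandard exponents form a finite antichain, and they generate the initial ideal by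
`isNonstandard_degree`. Tails are standard, and nonstandardness passes to multiples, so no leading
monomial divides a tail. -/
theorem isReducedGroebnerBasis_reducedBasis :
    IsReducedGroebnerBasis ord (latticeIdeal K A) (reducedBasis A ord K) := by
  have hlt : ∀ {a b : Fin n → ℕ}, Minimal (IsNonstandard A ord) a →
      A.mulVec (toInt b) = A.mulVec (toInt a) → ¬ IsNonstandard A ord b →
      ord.toSyn (expo b) < ord.toSyn (expo a) := fun {a b} ha hab hb =>
    lt_of_standard hb hab.symm fun h => hb (h ▸ ha.prop)
  have huniq : ∀ {a b : Fin n → ℕ}, ¬ IsNonstandard A ord a →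
      A.mulVec (toInt b) = A.mulVec (toInt a) → ¬ IsNonstandard A ord b → a = b := by
    intro a b ha hab hb
    by_contra hne
    exact lt_asymm (lt_of_standard hb hab.symm hne) (lt_of_standard ha hab (Ne.symm hne))
  have hsub : reducedBasis A ord K ⊆ latticeIdeal K A := by
    rintro _ ⟨a, b, -, hab, -, rfl⟩
    exact xpow_sub_mem_latticeIdeal hab.symm
  have hmonic : ∀ g ∈ reducedBasis A ord K, ord.Monic g := by
    rintro _ ⟨a, b, ha, hab, hb, rfl⟩
    exact monic_xpow_sub ord (hlt ha hab hb)
  refine ⟨?_, hsub, ?_, hmonic, ?_⟩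
  · choose μ hμ1 hμ2 using exists_standard A ord
    have hfin : {a | Minimal (IsNonstandard A ord) a}.Finite :=
      WellQuasiOrderedLE.finite_of_isAntichain (setOfPred_minimal_antichain _)
    refine (hfin.image fun a => xpow K a - xpow K (μ a)).subset ?_
    rintro _ ⟨a, b, ha, hab, hb, rfl⟩
    exact ⟨a, ha, by rw [huniq hb ((hμ1 a).trans hab.symm) (hμ2 a)]⟩
  · refine le_antisymm (Ideal.span_mono (Set.image_mono hsub)) (Ideal.span_le.2 ?_)
    rintro _ ⟨f, hf, rfl⟩
    by_cases hf0 : f = 0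
    · rw [hf0, ord.leadingTerm_zero]
      exact Submodule.zero_mem _
    obtain ⟨a, hle, ha⟩ := exists_minimal_le_of_wellFoundedLT _ _
      (isNonstandard_degree (ord := ord) hf hf0)
    obtain ⟨b, hab, hb⟩ := exists_standard A ord a
    rw [SetLike.mem_coe, span_leadingTerm_image_of_monic ord hmonic, mem_ideal_span_monomial_image,
      ord.support_leadingTerm' hf0]
    intro d hd
    rw [Finset.mem_singleton.1 hd]
    exact ⟨expo a, ⟨_, ⟨a, b, ha, hab, hb, rfl⟩, degree_xpow_sub ord (hlt ha hab hb)⟩, hle⟩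
  · rintro _ ⟨a, b, ha, hab, hb, rfl⟩ _ ⟨a', b', ha', hab', hb', rfl⟩ hne d hd hle
    rw [degree_xpow_sub ord (hlt ha' hab' hb')] at hle
    have hne' : a ≠ b := fun h => hb (h ▸ ha.prop)
    rw [support_xpow_sub hne', Finset.mem_insert, Finset.mem_singleton] at hd
    rcases hd with rfl | rfl
    · have h1 : a' = a := le_antisymm hle (ha.le_of_le ha'.prop hle)
      subst h1
      exact hne (by rw [huniq hb (hab'.trans hab.symm) hb'])
    · exact hb (ha'.prop.mono hle)

end Existence

/-! ### From vertices to a term order -/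

section Separation

variable {m n : ℕ}

/-- Removing an extreme point leaves a convex set, so `d` is outside the compact hull of the other
points and can be strictly separated from it. -/
theorem exists_weight_of_mem_extremePoints {S : Set (Fin n → ℕ)} (hS : S.Finite) {d : Fin n → ℕ}
    (hd : toReal d ∈ Set.extremePoints ℝ (convexHull ℝ (toReal '' S))) :
    ∃ c : Fin n → ℝ, ∀ t ∈ S, t ≠ d → ∑ i, c i * d i < ∑ i, c i * t i := by
  have hconv := ((Convex.mem_extremePoints_iff_convex_sdiff (convex_convexHull ℝ _)).1 hd).2
  have hnot : toReal d ∉ convexHull ℝ (toReal '' (S \ {d})) := by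
    have hsub : toReal '' (S \ {d}) ⊆ convexHull ℝ (toReal '' S) \ {toReal d} := by
      rintro _ ⟨t, ht, rfl⟩
      exact ⟨subset_convexHull ℝ _ ⟨t, ht.1, rfl⟩, fun h => ht.2 (toReal_injective h)⟩
    exact fun h => (convexHull_min hsub hconv h).2 rfl
  obtain ⟨f, s, hfd, hft⟩ := geometric_hahn_banach_point_closed (convex_convexHull ℝ _)
    (((hS.subset Set.sdiff_subset).image toReal).isCompact_convexHull ℝ).isClosed hnot
  have hfsum : ∀ y : Fin n → ℕ, f (toReal y) = ∑ i, f (Pi.single i 1) * y i := by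
    intro y
    conv_lhs => rw [pi_eq_sum_univ' (toReal y)]
    rw [map_sum]
    refine Finset.sum_congr rfl fun i _ => ?_
    rw [map_smul, smul_eq_mul, mul_comm, toReal]
  refine ⟨fun i => f (Pi.single i 1), fun t ht htd => ?_⟩
  rw [← hfsum, ← hfsum]
  exact hfd.trans (hft _ (subset_convexHull ℝ _ ⟨t, ⟨ht, htd⟩, rfl⟩))

variable {A : Matrix (Fin m) (Fin n) ℤ} {u : Fin n → ℤ}

/-- Vertices of the hulls of two different components are separated by one nonnegative weight,
which puts the second vertex below the whole fiber. -/
theorem exists_nonneg_weight (hA : IsPositiveLattice (kerLattice A))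
    {C D : (fiberGraph A u).ConnectedComponent} (hCD : C ≠ D) {v w : fiber A u} (hv0 : v.1 ≠ 0)
    (hv : toReal v.1 ∈ Set.extremePoints ℝ
      (convexHull ℝ ((fun w : fiber A u => toReal w.1) '' C.supp)))
    (hw : toReal w.1 ∈ Set.extremePoints ℝ
      (convexHull ℝ ((fun w : fiber A u => toReal w.1) '' D.supp))) :
    ∃ c : Fin n → ℝ, (∀ i, 0 ≤ c i) ∧
      (∀ t ∈ fiber A u, t ≠ w.1 → ∑ i, c i * w.1 i < ∑ i, c i * t i) ∧
      ∀ t ∈ C.supp, t ≠ v → ∑ i, c i * v.1 i < ∑ i, c i * t.1 i := by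
  classical
  have hmem : ∀ {E : (fiberGraph A u).ConnectedComponent} {x : fiber A u},
      toReal x.1 ∈ Set.extremePoints ℝ
        (convexHull ℝ ((fun w : fiber A u => toReal w.1) '' E.supp)) → x ∈ E.supp := by
    intro E x hx
    obtain ⟨y, hy, hyx⟩ := extremePoints_convexHull_subset hx
    rwa [← Subtype.ext (toReal_injective hyx)]
  have hvC := hmem hv
  have hwD := hmem hw
  have hfin : ∀ E : (fiberGraph A u).ConnectedComponent, (Subtype.val '' E.supp).Finite :=
    fun E => (fiber_finite hA u).subset (by rintro _ ⟨t, -, rfl⟩; exact t.2)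
  rw [← Set.image_image toReal Subtype.val] at hv hw
  obtain ⟨c₁, hc₁⟩ := exists_weight_of_mem_extremePoints (hfin C) hv
  obtain ⟨c₂, hc₂⟩ := exists_weight_of_mem_extremePoints (hfin D) hw
  obtain ⟨p, hp, hpconst⟩ := exists_pos_grading hA
  set h : ℝ := ∑ i, p i * v.1 i with hh
  have hpt : ∀ t ∈ fiber A u, ∑ i, p i * t i = h := fun t ht =>
    hpconst _ _ (((mem_fiber_iff A u t).1 ht).trans ((mem_fiber_iff A u v.1).1 v.2).symm)
  have hpos : 0 < h := by
    obtain ⟨i, hi⟩ := Function.ne_iff.1 hv0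
    refine Finset.sum_pos' (fun j _ => mul_nonneg (hp j).le (Nat.cast_nonneg _))
      ⟨i, Finset.mem_univ _, mul_pos (hp i) ?_⟩
    exact_mod_cast Nat.pos_of_ne_zero hi
  obtain ⟨B, hB⟩ := ((fiber_finite hA u).image fun t => ∑ i, c₁ i * (t i : ℝ)).bddBelow
  -- `N` is large enough to lift every fiber vector outside `D` above `w`, since `c₁ + N p` adds `N
  -- h` to its weight.
  obtain ⟨N, hN⟩ : ∃ N : ℝ, ∑ i, c₂ i * (w.1 i : ℝ) < B + N * h :=
    ⟨(∑ i, c₂ i * (w.1 i : ℝ) - B + 1) / h, by rw [div_mul_cancel₀ _ hpos.ne']; linarith⟩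
  -- Gluing is consistent because vectors outside `D` vanish on every coordinate used by `D`.
  let c : Fin n → ℝ := fun i => if ∃ t ∈ D.supp, t.1 i ≠ 0 then c₂ i else c₁ i + N * p i
  have hcD : ∀ t ∈ D.supp, ∑ i, c i * (t.1 i : ℝ) = ∑ i, c₂ i * t.1 i := by
    intro t ht
    refine Finset.sum_congr rfl fun i _ => ?_
    by_cases hi : t.1 i = 0
    · simp [hi]
    · simp only [c, if_pos (⟨t, ht, hi⟩ : ∃ t ∈ D.supp, t.1 i ≠ 0)]
  have hcC : ∀ t : fiber A u, t ∉ D.supp →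
      ∑ i, c i * (t.1 i : ℝ) = ∑ i, c₁ i * t.1 i + N * h := by
    intro t ht
    rw [← hpt t.1 t.2, Finset.mul_sum, ← Finset.sum_add_distrib]
    refine Finset.sum_congr rfl fun i _ => ?_
    by_cases hi : t.1 i = 0
    · simp [hi]
    · have hnot : ¬ ∃ s ∈ D.supp, s.1 i ≠ 0 := by
        rintro ⟨s, hs, hsi⟩
        refine hsi (eq_zero_of_ne_component (C := (fiberGraph A u).connectedComponentMk t)
          (fun h => ht ?_) rfl hs hi)
        rw [SimpleGraph.ConnectedComponent.mem_supp_iff, h]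
      simp only [c, if_neg hnot]
      ring
  -- Adding `R p` makes the weight nonnegative and shifts all fiber values by the same `R * h`.
  obtain ⟨R, hR⟩ : ∃ R : ℝ, ∀ i, 0 ≤ c i + R * p i := by
    refine ⟨∑ j, |c j| / p j, fun i => ?_⟩
    have h1 : |c i| / p i ≤ ∑ j, |c j| / p j :=
      Finset.single_le_sum (f := fun j => |c j| / p j)
        (fun j _ => div_nonneg (abs_nonneg _) (hp j).le) (Finset.mem_univ i)
    rw [div_le_iff₀ (hp i)] at h1
    linarith [neg_abs_le (c i)]
  have hshift : ∀ t ∈ fiber A u,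
      ∑ i, (c i + R * p i) * (t i : ℝ) = ∑ i, c i * (t i : ℝ) + R * h := by
    intro t ht
    rw [← hpt t ht, Finset.mul_sum, ← Finset.sum_add_distrib]
    exact Finset.sum_congr rfl fun i _ => by ring
  have hdisj : ∀ t ∈ C.supp, t ∉ D.supp := fun t htC htD => hCD (htC.symm.trans htD)
  refine ⟨fun i => c i + R * p i, hR, fun t ht htw => ?_, fun t ht htv => ?_⟩
  · rw [hshift t ht, hshift w.1 w.2, add_lt_add_iff_right, hcD w hwD]
    by_cases htD : (⟨t, ht⟩ : fiber A u) ∈ D.supp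
    · rw [hcD ⟨t, ht⟩ htD]
      exact hc₂ t ⟨⟨t, ht⟩, htD, rfl⟩ htw
    · rw [hcC ⟨t, ht⟩ htD]
      have := hB ⟨t, ht, rfl⟩
      simp only at this
      linarith
  · rw [hshift t.1 t.2, hshift v.1 v.2, add_lt_add_iff_right, hcC v (hdisj v hvC),
      hcC t (hdisj t ht), add_lt_add_iff_right]
    exact hc₁ t.1 ⟨t, ht, rfl⟩ fun h => htv (Subtype.ext h)

/-- If `v = a + e` with `e ≠ 0` and some `t` in the fiber of `a` precedes `a`, then `t + e` precedes
`v` and shares with it a coordinate of `e`. It thus lies in the component of `v`, where `v` is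
smallest. -/
theorem minimal_isNonstandard {ord : MonomialOrder (Fin n)}
    {C : (fiberGraph A u).ConnectedComponent} {v : fiber A u} (hvC : v ∈ C.supp)
    (hv : IsNonstandard A ord v.1)
    (hmin : ∀ t ∈ C.supp, t ≠ v → ord.toSyn (expo v.1) < ord.toSyn (expo t.1)) :
    Minimal (IsNonstandard A ord) v.1 := by
  refine ⟨hv, fun a ⟨t, hta, hlt⟩ hav => ?_⟩
  obtain ⟨e, he⟩ := exists_add_of_le hav
  by_cases he0 : e = 0
  · rw [he, he0, add_zero]
  obtain ⟨i, hi⟩ := Function.ne_iff.1 he0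
  have hlt' : ord.toSyn (expo (t + e)) < ord.toSyn (expo v.1) := by
    rw [he, expo_add, expo_add, map_add, map_add]
    exact add_lt_add_left hlt _
  have hfib : t + e ∈ fiber A u := by
    rw [mem_fiber_iff, ← (mem_fiber_iff A u _).1 v.2, he, toInt_add, toInt_add, Matrix.mulVec_add,
      Matrix.mulVec_add, hta]
  have hne : (⟨t + e, hfib⟩ : fiber A u) ≠ v := by
    intro h
    rw [← h] at hlt'
    exact lt_irrefl _ hlt'
  have hadj : (fiberGraph A u).Adj ⟨t + e, hfib⟩ v := by
    have hi' : e i ≠ 0 := hi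
    refine ⟨hne, i, ?_, ?_⟩
    · simp [hi']
    · rw [he]; simp [hi']
  refine absurd (hmin ⟨t + e, hfib⟩ ?_ hne) hlt'.not_gt
  rw [SimpleGraph.ConnectedComponent.mem_supp_iff] at hvC ⊢
  rw [← hvC]
  exact SimpleGraph.ConnectedComponent.connectedComponentMk_eq_of_adj hadj

theorem mem_universalGroebnerBasis_of_mem_extremePoints (K : Type*) [Field K]
    (hA : IsPositiveLattice (kerLattice A)) (hu : u ∈ kerLattice A)
    {C D : (fiberGraph A u).ConnectedComponent} (hCD : C ≠ D)
    (hpos : toReal (posVec u) ∈ Set.extremePoints ℝ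
      (convexHull ℝ ((fun w : fiber A u => toReal w.1) '' C.supp)))
    (hneg : toReal (negVec u) ∈ Set.extremePoints ℝ
      (convexHull ℝ ((fun w : fiber A u => toReal w.1) '' D.supp))) :
    u ∈ universalGroebnerBasis K A := by
  obtain ⟨v, hvC, hv⟩ := extremePoints_convexHull_subset hpos
  obtain ⟨w, hwD, hw⟩ := extremePoints_convexHull_subset hneg
  have hv := toReal_injective hv
  have hw := toReal_injective hw
  have hvw : v ≠ w := by
    rintro rfl
    exact hCD (hvC.symm.trans hwD)
  have hker := mulVec_posVec_eq A hu
  have hv0 : v.1 ≠ 0 := by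
    intro h0
    refine hvw (Subtype.ext (eq_of_le_of_mulVec_eq hA ?_ (by rw [hv, hw, hker])))
    rw [h0]
    exact fun i => Nat.zero_le _
  rw [← hv] at hpos
  rw [← hw] at hneg
  obtain ⟨c, hc0, hcw, hcv⟩ := exists_nonneg_weight hA hCD hv0 hpos hneg
  have hstd : ¬ IsNonstandard A (weightOrder c hc0) w.1 := by
    rintro ⟨t, ht, hlt⟩
    have htu : t ∈ fiber A u := (mem_fiber_iff A u t).2 (ht.trans ((mem_fiber_iff A u _).1 w.2))
    refine hlt.not_gt (weightOrder_lt hc0 (hcw t htu ?_))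
    rintro rfl
    exact lt_irrefl _ hlt
  have hnon : IsNonstandard A (weightOrder c hc0) v.1 :=
    ⟨w.1, by rw [hv, hw, hker],
      weightOrder_lt hc0 (hcw v.1 v.2 fun h => hvw (Subtype.ext h))⟩
  refine ⟨hu, weightOrder c hc0, reducedBasis A _ K, isReducedGroebnerBasis_reducedBasis,
    posVec u, negVec u, ?_, hker.symm, hw ▸ hstd, rfl⟩
  rw [← hv]
  exact minimal_isNonstandard hvC hnon fun t ht htv => weightOrder_lt hc0 (hcv t ht htv)

end Separation

end MarkovBases

theorem mainTheorem4 (K : Type*) [Field K] {m n : ℕ} (A : Matrix (Fin m) (Fin n) ℤ)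
    (hA : IsPositiveLattice (kerLattice A)) (u : Fin n → ℤ) (hu : u ∈ universalMarkovBasis A) :
    u ∈ universalGroebnerBasis K A ↔
      ∃ P ∈ markovPolytopes A u, ∃ Q ∈ markovPolytopes A u, P ≠ Q ∧
        toReal (posVec u) ∈ Set.extremePoints ℝ P ∧
        toReal (negVec u) ∈ Set.extremePoints ℝ Q := by
  have hk := mem_kerLattice_of_mem_universalMarkovBasis hu
  constructor
  · rintro ⟨-, ord, G, hG, hmem⟩
    let v : fiber A u := ⟨posVec u, posVec_mem_fiber A u⟩
    let w : fiber A u := ⟨negVec u, negVec_mem_fiber A hk⟩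
    have hr : ¬ (fiberGraph A u).Reachable v w := not_reachable_of_mem_universalMarkovBasis hA hu
    have hne : posVec u ≠ negVec u := by
      intro h
      have hvw : v = w := Subtype.ext h
      exact hr (hvw ▸ SimpleGraph.Reachable.refl v)
    have hCD : (fiberGraph A u).connectedComponentMk v ≠ (fiberGraph A u).connectedComponentMk w :=
      fun h => hr (SimpleGraph.ConnectedComponent.exact h)
    have hv0 : posVec u ≠ 0 := by
      intro h0
      refine hne (eq_of_le_of_mulVec_eq hA ?_ (mulVec_posVec_eq A hk))
      rw [h0]
      exact fun i => Nat.zero_le _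
    exact ⟨_, ⟨_, rfl⟩, _, ⟨_, rfl⟩, convexHull_component_ne hCD (w := v) rfl hv0,
      toReal_mem_extremePoints_of_mem_groebner hA hk hne hG hmem (d := v) (Or.inl rfl) rfl,
      toReal_mem_extremePoints_of_mem_groebner hA hk hne hG hmem (d := w) (Or.inr rfl) rfl⟩
  · rintro ⟨_, ⟨C, rfl⟩, _, ⟨D, rfl⟩, hne, hpos, hneg⟩
    exact mem_universalGroebnerBasis_of_mem_extremePoints K hA hk (fun h => hne (by rw [h]))
      hpos hneg
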